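/- **Setting.** Let $H$ be a reproducing kernel Hilbert space of real-valued functions on a set $X$, with reproducing kernel $k$ and feature map $\phi(x)=k(x,\cdot)\in H$. Fix points of $X$ representing the times $1,2,\dots$ (for example the integers themselves) and write $k(s,t)$, $\phi(t)$ for the values at the points representing $s,t$. Let $L(H,\mathbb R^d)$ be the bounded linear operators from $H$ to $\mathbb R^d$, with Hilbert–Schmidt norm $\|A\|_{HS}=(\sum_i\|Ah_i\|^2)^{1/2}$, $(h_i)$ any orthonormal basis of $H$. Let $G\ge 0$, $\epsilon>0$, $T\in\mathbb N$, put $G_0=G\max_{1\le t\le T}\sqrt{k(t,t)}$ and assume $G_0>0$. For $V>0$ and $S\ge 0$ let $\alpha(V)=\dfrac{\epsilon G_0}{\sqrt V\,\log^2(V/G_0^2)}$ and $$\Psi(S,V)=\begin{cases}\alpha(V)\left[\exp\left(\frac{S^2}{36V}\right)-1\right]&\text{if }S\le 6V/G_0,\\[1ex] \alpha(V)\left[\exp\left(\frac{S}{3G_0}-\frac{V}{G_0^2}\right)-1\right]&\text{otherwise.}\end{cases}$$ **Algorithm (kernelized parameter-free learning).** Start with $w_1=0$, $V_1=4G_0^2$,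 $S_1=0$. On round $t$ play $w_t\in\mathbb R^d$, receive $g_t\in\mathbb R^d$, and set $V_{t+1}=V_t+\|g_t\|^2k(t,t)$, $S_{t+1}^2=S_t^2+k(t,t)\|g_t\|^2+2\sum_{s=1}^{t-1}k(s,t)\langle g_t,g_s\rangle$ with $S_{t+1}\ge 0$, and $$w_{t+1}=\frac{-\sum_{s=1}^{t}k(s,t+1)\,g_s}{S_{t+1}}\,\Psi(S_{t+1},V_{t+1})\qquad(w_{t+1}=0\text{ if }S_{t+1}=0).$$ Its underlying operators are, with $G_s=g_s\otimes\phi(s)\in L(H,\mathbb R^d)$, i.e. $G_s h=\langle\phi(s),h\rangle g_s$, $$W_1=0,\qquad W_{t+1}=\frac{-\sum_{s=1}^tG_s}{\|\sum_{s=1}^tG_s\|_{HS}}\,\Psi\left(\Big\|\sum_{s=1}^tG_s\Big\|_{HS},\;4G_0^2+\sum_{s=1}^t\|G_s\|_{HS}^2\right)$$ (again $0$ if $\sum_{s=1}^tG_s=0$). **Proposition (KernelizedPF).** Let $\ell_1,\dots,\ell_T:\mathbb R^d\to\mathbb R$ be convex and $G$-Lipschitz for the Euclidean norm, and run the algorithm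 with $g_t\in\partial\ell_t(w_t)$ for $t=1,\dots,T$. Then for all $u_1,\dots,u_T\in\mathbb R^d$ and every $U\in L(H,\mathbb R^d)$ with $u_t=U\phi(t)$ for $t=1,\dots,T$, $$\sum_{t=1}^T\big(\ell_t(w_t)-\ell_t(u_t)\big)=\sum_{t=1}^T\big(\ell_t(W_t\phi(t))-\ell_t(U\phi(t))\big),$$ and $$\sum_{t=1}^T\big(\ell_t(w_t)-\ell_t(u_t)\big)\le 4G_0\epsilon+6\|U\|_{HS}\max\left\{\sqrt{V_{T+1}\log\left(\frac{\|U\|_{HS}}{\alpha_{T+1}}+1\right)},\;G_0\log\left(\frac{\|U\|_{HS}}{\alpha_{T+1}}+1\right)\right\},$$ where $V_{T+1}=4G_0^2+\sum_{t=1}^T\|g_t\|^2k(t,t)$ and $\alpha_{T+1}=\alpha(V_{T+1})$. -/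

import Mathlib

open scoped NNReal

noncomputable section

namespace KernelOCO

section Space

variable {X H : Type*} [NormedAddCommGroup H] [InnerProductSpace ℝ H] [CompleteSpace H]

/-- The feature map `φ(x) = k_x ∈ H` of a real-valued reproducing kernel Hilbert space: the Riesz
representer of the evaluation functional at `x`. -/
def feature (H : Type*) [NormedAddCommGroup H] [InnerProductSpace ℝ H] [CompleteSpace H]
    [RKHS ℝ H X ℝ] (x : X) : H :=
  RKHS.kerFun H x (1 : ℝ)

/-- The reproducing kernel `k(x, x') = k_x(x')`. -/
def repKernel (H : Type*) [NormedAddCommGroup H] [InnerProductSpace ℝ H] [CompleteSpace H]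
    [RKHS ℝ H X ℝ] (x x' : X) : ℝ :=
  (feature H x : X → ℝ) x'

/-- The reproducing property `⟪h, φ(x)⟫ = h(x)`. -/
theorem inner_feature [RKHS ℝ H X ℝ] (h : H) (x : X) :
    inner ℝ h (feature H x) = h x := by
  simp [feature]

theorem repKernel_eq_inner [RKHS ℝ H X ℝ] (x x' : X) :
    repKernel H x x' = inner ℝ (feature H x) (feature H x') := by
  rw [inner_feature]; rfl

/-- The Hilbert-Schmidt norm `(∑ᵢ ‖A hᵢ‖²)^(1/2)`, computed in some Hilbert basis `(hᵢ)` of `H`;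
by `hasSum_hsNorm_sq` the value is the same for every Hilbert basis. -/
def hsNorm {F : Type*} [NormedAddCommGroup F] [InnerProductSpace ℝ F] (A : H →L[ℝ] F) : ℝ :=
  Real.sqrt (∑' i, ‖A ((exists_hilbertBasis ℝ H).choose_spec.choose i)‖ ^ 2)

theorem hasSum_norm_sq_hilbertBasis {F : Type*} [NormedAddCommGroup F] [InnerProductSpace ℝ F]
    [FiniteDimensional ℝ F] (A : H →L[ℝ] F) {ι : Type*} (b : HilbertBasis ι ℝ H) :
    HasSum (fun i => ‖A (b i)‖ ^ 2)
      (∑ j, ‖ContinuousLinearMap.adjoint A (stdOrthonormalBasis ℝ F j)‖ ^ 2) := by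
  have h : ∀ j, HasSum (fun i => inner ℝ (stdOrthonormalBasis ℝ F j) (A (b i)) ^ 2)
      (‖ContinuousLinearMap.adjoint A (stdOrthonormalBasis ℝ F j)‖ ^ 2) := by
    intro j
    have := b.hasSum_inner_mul_inner (ContinuousLinearMap.adjoint A (stdOrthonormalBasis ℝ F j))
      (ContinuousLinearMap.adjoint A (stdOrthonormalBasis ℝ F j))
    rw [real_inner_self_eq_norm_sq] at this
    have e : (fun i => inner ℝ (stdOrthonormalBasis ℝ F j) (A (b i)) ^ 2) = fun i =>
        inner ℝ (ContinuousLinearMap.adjoint A (stdOrthonormalBasis ℝ F j)) (b i) *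
        inner ℝ (b i) (ContinuousLinearMap.adjoint A (stdOrthonormalBasis ℝ F j)) := by
      funext i
      rw [ContinuousLinearMap.adjoint_inner_left, ContinuousLinearMap.adjoint_inner_right,
        real_inner_comm (stdOrthonormalBasis ℝ F j) (A (b i)), sq]
    rw [e]
    exact this
  have e : (fun i => ‖A (b i)‖ ^ 2) = fun i =>
      ∑ j, inner ℝ (stdOrthonormalBasis ℝ F j) (A (b i)) ^ 2 := by
    funext i
    exact ((stdOrthonormalBasis ℝ F).sum_sq_inner_right (A (b i))).symm
  rw [e]
  exact hasSum_sum fun j _ => h j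

theorem hasSum_hsNorm_sq {F : Type*} [NormedAddCommGroup F] [InnerProductSpace ℝ F]
    [FiniteDimensional ℝ F] (A : H →L[ℝ] F) {ι : Type*} (b : HilbertBasis ι ℝ H) :
    HasSum (fun i => ‖A (b i)‖ ^ 2) (hsNorm A ^ 2) := by
  have h0 := hasSum_norm_sq_hilbertBasis A (exists_hilbertBasis ℝ H).choose_spec.choose
  rw [hsNorm, Real.sq_sqrt (tsum_nonneg fun i => sq_nonneg _), h0.tsum_eq]
  exact hasSum_norm_sq_hilbertBasis A b

end Space

section Regret

variable {E : Type*}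

/-- The subdifferential of `f` at `w`. -/
def subdifferential [NormedAddCommGroup E] [InnerProductSpace ℝ E] (f : E → ℝ) (w : E) : Set E :=
  {g | ∀ v, f w + inner ℝ g (v - w) ≤ f v}

/-- Dynamic regret over rounds `1, …, T` of the plays `w` against the comparator sequence `u`. -/
def dynamicRegret (T : ℕ) (ℓ : ℕ → E → ℝ) (w u : ℕ → E) : ℝ :=
  ∑ t ∈ Finset.Icc 1 T, (ℓ t (w t) - ℓ t (u t))

/-- Static regret over rounds `1, …, T` of the points `W` against the fixed comparator `U`. -/
def staticRegret (T : ℕ) (ℓ : ℕ → E → ℝ) (W : ℕ → E) (U : E) : ℝ :=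
  ∑ t ∈ Finset.Icc 1 T, (ℓ t (W t) - ℓ t U)

end Regret

section Algorithm

/-- The Lipschitz constant `G₀ = G · max_{1 ≤ t ≤ T} √k(t,t)` of the lifted losses. -/
def liftedLipschitz (k : ℕ → ℕ → ℝ) (G : ℝ) (T : ℕ) : ℝ :=
  G * ⨆ t : Finset.Icc 1 T, Real.sqrt (k t t)

/-- `α(V) = ε G₀ / (√V log²(V / G₀²))`. -/
def alpha (ε G₀ V : ℝ) : ℝ :=
  ε * G₀ / (Real.sqrt V * Real.log (V / G₀ ^ 2) ^ 2)

/-- The potential `Ψ(S, V)`. -/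
def potential (ε G₀ S V : ℝ) : ℝ :=
  if S ≤ 6 * V / G₀ then
    alpha ε G₀ V * (Real.exp (S ^ 2 / (36 * V)) - 1)
  else
    alpha ε G₀ V * (Real.exp (S / (3 * G₀) - V / G₀ ^ 2) - 1)

variable {E : Type*} [NormedAddCommGroup E] [InnerProductSpace ℝ E]

/-- `V₁ = 4 G₀²`, `V_{t+1} = V_t + ‖g_t‖² k(t,t)`. Rounds are numbered from `1`; index `0` is
unused here and below. -/
def algV (k : ℕ → ℕ → ℝ) (G₀ : ℝ) (g : ℕ → E) : ℕ → ℝ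
  | 0 => 4 * G₀ ^ 2
  | 1 => 4 * G₀ ^ 2
  | t + 2 => algV k G₀ g (t + 1) + ‖g (t + 1)‖ ^ 2 * k (t + 1) (t + 1)

/-- `S_t²`, where `S₁ = 0` and
`S_{t+1}² = S_t² + k(t,t) ‖g_t‖² + 2 ∑_{s=1}^{t-1} k(s,t) ⟪g_t, g_s⟫`. -/
def algSqS (k : ℕ → ℕ → ℝ) (g : ℕ → E) : ℕ → ℝ
  | 0 => 0
  | 1 => 0
  | t + 2 => algSqS k g (t + 1) + k (t + 1) (t + 1) * ‖g (t + 1)‖ ^ 2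
      + 2 * ∑ s ∈ Finset.Icc 1 t, k s (t + 1) * inner ℝ (g (t + 1)) (g s)

/-- `S_t ≥ 0`. -/
def algS (k : ℕ → ℕ → ℝ) (g : ℕ → E) (t : ℕ) : ℝ := Real.sqrt (algSqS k g t)

/-- The point played on round `t`, as a function of the subgradients `g₁, …, g_{t-1}`:
`w₁ = 0` and `w_{t+1} = -(∑_{s=1}^t k(s,t+1) g_s) Ψ(S_{t+1}, V_{t+1}) / S_{t+1}`
(which is `0` when `S_{t+1} = 0`). -/
def play (k : ℕ → ℕ → ℝ) (ε G₀ : ℝ) (g : ℕ → E) : ℕ → E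
  | 0 => 0
  | 1 => 0
  | t + 2 =>
      (potential ε G₀ (algS k g (t + 2)) (algV k G₀ g (t + 2)) / algS k g (t + 2)) •
        (-∑ s ∈ Finset.Icc 1 (t + 1), k s (t + 2) • g s)

/-- The operators `W_t ∈ L(H, E)` underlying the algorithm: with `G_s = g_s ⊗ φ(s)`, `W₁ = 0` and
`W_{t+1} = -(∑_{s=1}^t G_s) Ψ(‖∑_{s=1}^t G_s‖_HS, V_{t+1}) / ‖∑_{s=1}^t G_s‖_HS`, where
`V_{t+1} = 4 G₀² + ∑_{s=1}^t ‖G_s‖²_HS`. -/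
def operatorIterate {H : Type*} [NormedAddCommGroup H] [InnerProductSpace ℝ H] [CompleteSpace H]
    (φ : ℕ → H) (ε G₀ : ℝ) (g : ℕ → E) (t : ℕ) : H →L[ℝ] E :=
  let θ : H →L[ℝ] E := ∑ s ∈ Finset.Ico 1 t, InnerProductSpace.rankOne ℝ (g s) (φ s)
  let V : ℝ := 4 * G₀ ^ 2 +
    ∑ s ∈ Finset.Ico 1 t, hsNorm (InnerProductSpace.rankOne ℝ (g s) (φ s)) ^ 2
  (potential ε G₀ (hsNorm θ) V / hsNorm θ) • (-θ)

end Algorithm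

end KernelOCO

end

/-!
Hilbert-Schmidt operators `H →L[ℝ] F` embed isometrically into a power of `H`, with
`⟪g ⊗ φ(t), A⟫ = ⟪g, A φ(t)⟫`. By linearization the claim becomes a bound on the linear regret of a
parameter-free learner in an inner product space, and by homogeneity one may take `G₀ = 1`.

For `G₀ = 1` the potential is `α(v) (exp (huber v s) - 1)`, where `huber v s` is the maximum over
`b ≤ 1/3` of `b s - 9 v b²`; its convexity in `s` and its monotonicity in `v` are read off from this
form. The primitive `Φ_v(‖θ‖)` of the potential is the energy of the gradient sum `θ`. When a
gradient `z` arrives, a second-order radial expansion of `Φ_v` has minus the loss of the round as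
its linear term, and replacing `v` by `v + ‖z‖²` lowers the energy by nearly enough to pay for the
quadratic term. The deficit is at most `4 ε (1 / log v - 1 / log (v + ‖z‖²))`, which telescopes.
Finally the Fenchel conjugate of `Φ_v` at the norm of the comparator bounds the regret.
-/

noncomputable section

namespace KernelOCO

section Calculus

variable {f f' g g' : ℝ → ℝ} {a b M s t : ℝ}

theorem sub_le_sub_of_hasDerivAt_le (hab : a ≤ b)
    (hf : ∀ x ∈ Set.Icc a b, HasDerivAt f (f' x) x) (hg : ∀ x ∈ Set.Icc a b, HasDerivAt g (g' x) x)
    (h : ∀ x ∈ Set.Ioo a b, f' x ≤ g' x) : f b - f a ≤ g b - g a := by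
  have hd : ∀ x ∈ Set.Icc a b, HasDerivAt (g - f) (g' x - f' x) x := fun x hx =>
    (hg x hx).sub (hf x hx)
  have hmono : MonotoneOn (g - f) (Set.Icc a b) :=
    monotoneOn_of_hasDerivWithinAt_nonneg (convex_Icc a b)
      (fun x hx => (hd x hx).continuousAt.continuousWithinAt)
      (fun x hx => (hd x (interior_subset hx)).hasDerivWithinAt)
      (fun x hx => sub_nonneg.2 (h x (interior_Icc (a := a) (b := b) ▸ hx)))
  have := hmono (Set.left_mem_Icc.2 hab) (Set.right_mem_Icc.2 hab) hab
  simp only [Pi.sub_apply] at this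
  linarith

theorem le_add_mul_sub_add_sq_of_deriv_le (hg : ∀ x ∈ Set.Icc a b, HasDerivAt g (f x) x)
    (hf : ∀ x ∈ Set.Icc a b, HasDerivAt f (f' x) x) (hM : ∀ x ∈ Set.Icc a b, f' x ≤ M)
    (hs : s ∈ Set.Icc a b) (ht : t ∈ Set.Icc a b) :
    g t ≤ g s + f s * (t - s) + M / 2 * (t - s) ^ 2 := by
  have slope : ∀ x ∈ Set.Icc a b, ∀ y ∈ Set.Icc a b, x ≤ y → f y - f x ≤ M * (y - x) :=
    fun x hx y hy hxy => by
      have hsub := Set.Icc_subset_Icc hx.1 hy.2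
      have := sub_le_sub_of_hasDerivAt_le hxy (fun r hr => hf r (hsub hr))
        (fun r _ => (hasDerivAt_id r).const_mul M)
        fun r hr => by simpa using hM r (hsub (Set.Ioo_subset_Icc_self hr))
      simpa [mul_sub] using this
  have hquad : ∀ r, HasDerivAt (fun r => f s * (r - s) + M / 2 * (r - s) ^ 2)
      (f s + M * (r - s)) r := fun r => by
    have hr := (hasDerivAt_id r).sub_const s
    exact ((hr.const_mul (f s)).add ((hr.pow 2).const_mul (M / 2))).congr_deriv (by simp; ring)
  rcases le_total s t with hst | hts
  · have hsub := Set.Icc_subset_Icc hs.1 ht.2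
    have := sub_le_sub_of_hasDerivAt_le hst (fun r hr => hg r (hsub hr)) (fun r _ => hquad r)
      fun r hr => by
        linarith [slope s hs r (hsub (Set.Ioo_subset_Icc_self hr)) hr.1.le]
    simp only [sub_self] at this
    linarith
  · have hsub := Set.Icc_subset_Icc ht.1 hs.2
    have := sub_le_sub_of_hasDerivAt_le hts (fun r _ => hquad r) (fun r hr => hg r (hsub hr))
      fun r hr => by
        linarith [slope r (hsub (Set.Ioo_subset_Icc_self hr)) s hs hr.2.le]
    simp only [sub_self] at this
    linarith

theorem radial_le_add_inner_add_sq {E : Type*} [NormedAddCommGroup E] [InnerProductSpace ℝ E]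
    (hg : ∀ x ∈ Set.Icc 0 b, HasDerivAt g (f x) x)
    (hf : ∀ x ∈ Set.Icc 0 b, HasDerivAt f (f' x) x) (hM : ∀ x ∈ Set.Icc 0 b, f' x ≤ M)
    (hf0 : f 0 = 0) {θ z : E} (hθ : ‖θ‖ ≤ b) (hθz : ‖θ + z‖ ≤ b) :
    g ‖θ + z‖ ≤ g ‖θ‖ + f ‖θ‖ / ‖θ‖ * inner ℝ θ z + M / 2 * ‖z‖ ^ 2 := by
  have hθ_mem : ‖θ‖ ∈ Set.Icc 0 b := ⟨norm_nonneg θ, hθ⟩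
  have taylor := le_add_mul_sub_add_sq_of_deriv_le hg hf hM hθ_mem ⟨norm_nonneg (θ + z), hθz⟩
  have slope : f ‖θ‖ ≤ M * ‖θ‖ := by
    have := sub_le_sub_of_hasDerivAt_le hθ_mem.1
      (fun r hr => hf r (Set.Icc_subset_Icc le_rfl hθ hr))
      (fun r _ => (hasDerivAt_id r).const_mul M)
      fun r hr => by simpa using hM r ⟨hr.1.le, hr.2.le.trans hθ⟩
    simpa [hf0] using this
  have hz : (‖θ + z‖ - ‖θ‖) ^ 2 ≤ ‖z‖ ^ 2 := by
    rw [sq_le_sq, abs_norm]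
    simpa using abs_norm_sub_norm_le (θ + z) θ
  have hexcess : f ‖θ‖ * (‖θ + z‖ - ‖θ‖) ≤
      f ‖θ‖ / ‖θ‖ * inner ℝ θ z + M / 2 * (‖z‖ ^ 2 - (‖θ + z‖ - ‖θ‖) ^ 2) := by
    rcases (norm_nonneg θ).eq_or_lt with h0 | hpos
    · have : θ = 0 := norm_eq_zero.1 h0.symm
      simp [this, hf0]
    · -- As `f ‖θ‖ / ‖θ‖ ≤ M`, the quadratic term pays for the difference between `‖θ + z‖ - ‖θ‖`
      -- and its linear part.
      have hdiff : ‖θ + z‖ - ‖θ‖ =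
          (inner ℝ θ z + (‖z‖ ^ 2 - (‖θ + z‖ - ‖θ‖) ^ 2) / 2) / ‖θ‖ := by
        rw [eq_div_iff hpos.ne']
        linarith [norm_add_sq_real θ z]
      have hratio : f ‖θ‖ / ‖θ‖ ≤ M := (div_le_iff₀ hpos).2 slope
      calc f ‖θ‖ * (‖θ + z‖ - ‖θ‖)
          = f ‖θ‖ / ‖θ‖ * inner ℝ θ z +
            f ‖θ‖ / ‖θ‖ * ((‖z‖ ^ 2 - (‖θ + z‖ - ‖θ‖) ^ 2) / 2) := by
            conv_lhs => rw [hdiff]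
            ring
        _ ≤ f ‖θ‖ / ‖θ‖ * inner ℝ θ z + M * ((‖z‖ ^ 2 - (‖θ + z‖ - ‖θ‖) ^ 2) / 2) := by
            gcongr
        _ = _ := by ring
  linarith

end Calculus

section Huber

/-- The slope `min (s / (18 v)) (1 / 3)` of `huber v` at `s`. -/
def huberSlope (v s : ℝ) : ℝ := min (s / (18 * v)) (1 / 3)

/-- The exponent of the potential with `G₀ = 1`, written in its dual form
`max_{b ≤ 1/3} (b s - 9 v b²)` with the maximizer `b = huberSlope v s`; it is quadratic for
`s ≤ 6 v` and affine beyond. -/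
def huber (v s : ℝ) : ℝ := huberSlope v s * s - 9 * v * huberSlope v s ^ 2

variable {v v' b s t L : ℝ}

theorem huberSlope_le : huberSlope v s ≤ 1 / 3 := min_le_right _ _

theorem huberSlope_nonneg (hv : 0 < v) (hs : 0 ≤ s) : 0 ≤ huberSlope v s :=
  le_min (by positivity) (by norm_num)

theorem huberSlope_mono (hv : 0 < v) (h : s ≤ t) : huberSlope v s ≤ huberSlope v t := by
  unfold huberSlope; gcongr

theorem continuous_huberSlope (v : ℝ) : Continuous (huberSlope v) := by
  unfold huberSlope; fun_prop

theorem huberSlope_of_le (hv : 0 < v) (h : s ≤ 6 * v) : huberSlope v s = s / (18 * v) :=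
  min_eq_left ((div_le_iff₀ (by positivity)).2 (by linarith))

theorem huberSlope_of_ge (hv : 0 < v) (h : 6 * v ≤ s) : huberSlope v s = 1 / 3 :=
  min_eq_right ((le_div_iff₀ (by positivity)).2 (by linarith))

theorem huberSlope_le_add (hv : 0 < v) (h : s ≤ t) :
    huberSlope v t ≤ huberSlope v s + (t - s) / (18 * v) := by
  have hdiv : 0 ≤ (t - s) / (18 * v) := div_nonneg (sub_nonneg.2 h) (by positivity)
  calc huberSlope v t
      ≤ min (s / (18 * v) + (t - s) / (18 * v)) (1 / 3 + (t - s) / (18 * v)) :=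
        min_le_min (by rw [← add_div, add_sub_cancel]) (by linarith)
    _ = _ := min_add_add_right _ _ _

theorem huber_of_le (hv : 0 < v) (h : s ≤ 6 * v) : huber v s = s ^ 2 / (36 * v) := by
  rw [huber, huberSlope_of_le hv h]; field_simp; ring

theorem huber_of_ge (hv : 0 < v) (h : 6 * v ≤ s) : huber v s = s / 3 - v := by
  rw [huber, huberSlope_of_ge hv h]; ring

theorem mul_sub_le_huber (hv : 0 < v) (hb : b ≤ 1 / 3) : b * s - 9 * v * b ^ 2 ≤ huber v s := by
  rcases le_total s (6 * v) with h | h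
  · rw [huber_of_le hv h, le_div_iff₀ (by positivity)]
    nlinarith [sq_nonneg (s - 18 * v * b)]
  · rw [huber_of_ge hv h]
    nlinarith [mul_nonneg (sub_nonneg.2 hb) (sub_nonneg.2 h),
      mul_nonneg hv.le (sq_nonneg (b - 1 / 3))]

theorem huber_nonneg (hv : 0 < v) : 0 ≤ huber v s := by
  simpa using mul_sub_le_huber (s := s) hv (b := 0) (by norm_num)

theorem huber_zero (hv : 0 < v) : huber v 0 = 0 := by
  simp [huber_of_le hv (s := 0) (by positivity)]

theorem nine_mul_sq_le_huber (hv : 0 < v) (hs : 0 ≤ s) :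
    9 * v * huberSlope v s ^ 2 ≤ huber v s := by
  have hc : huberSlope v s * (18 * v) ≤ s := (le_div_iff₀ (by positivity)).1 (min_le_left _ _)
  have := mul_le_mul_of_nonneg_left hc (huberSlope_nonneg hv hs)
  unfold huber
  linarith

theorem huber_add_slope_mul_le (hv : 0 < v) : huber v s + huberSlope v s * (t - s) ≤ huber v t :=
  (mul_sub_le_huber hv huberSlope_le).trans' (by rw [huber]; linarith)

theorem huber_mono (hv : 0 < v) (hs : 0 ≤ s) (h : s ≤ t) : huber v s ≤ huber v t :=
  (huber_add_slope_mul_le hv).trans'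
    (le_add_of_nonneg_right (mul_nonneg (huberSlope_nonneg hv hs) (sub_nonneg.2 h)))

theorem huber_add_mul_scale_sub_le (hv : 0 < v) :
    huber v' s + 9 * huberSlope v' s ^ 2 * (v' - v) ≤ huber v s :=
  (mul_sub_le_huber hv huberSlope_le).trans' (by rw [huber]; linarith)

theorem hasDerivAt_huber (hv : 0 < v) (s : ℝ) : HasDerivAt (huber v) (huberSlope v s) s := by
  rw [hasDerivAt_iff_isLittleO]
  refine Asymptotics.IsBigO.trans_isLittleO ?_ (Asymptotics.isLittleO_pow_sub_sub s one_lt_two)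
  refine Asymptotics.IsBigO.of_bound (1 / (18 * v)) (Filter.Eventually.of_forall fun t => ?_)
  have tangent_s := huber_add_slope_mul_le (s := s) (t := t) hv
  have tangent_t := huber_add_slope_mul_le (s := t) (t := s) hv
  have slope : (huberSlope v t - huberSlope v s) * (t - s) ≤ 1 / (18 * v) * (t - s) ^ 2 := by
    rw [sq, ← mul_assoc, one_div_mul_eq_div]
    rcases le_total s t with h | h
    · exact mul_le_mul_of_nonneg_right (by linarith [huberSlope_le_add hv h]) (by linarith)
    · refine mul_le_mul_of_nonpos_right ?_ (by linarith)
      rw [← neg_sub s t, neg_div]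
      linarith [huberSlope_le_add hv h]
  simp only [smul_eq_mul, norm_pow, Real.norm_eq_abs, sq_abs]
  rw [abs_of_nonneg (by linarith)]
  linarith

theorem le_huber_of_six_mul_max_le (hv : 0 < v) (hL : 0 ≤ L) (hs : 6 * max (√(v * L)) L ≤ s) :
    L ≤ huber v s := by
  rcases le_total L v with h | h
  · have hb : √L / (3 * √v) ≤ 1 / 3 := by
      rw [div_le_iff₀ (by positivity)]
      linarith [Real.sqrt_le_sqrt h]
    have hs' : 6 * (√v * √L) ≤ s := by
      rw [← Real.sqrt_mul hv.le]
      linarith [le_max_left (√(v * L)) L]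
    calc L = √L / (3 * √v) * (6 * (√v * √L)) - 9 * v * (√L / (3 * √v)) ^ 2 := by
          field_simp
          rw [Real.sq_sqrt hL, Real.sq_sqrt hv.le]
          ring
      _ ≤ √L / (3 * √v) * s - 9 * v * (√L / (3 * √v)) ^ 2 := by gcongr
      _ ≤ huber v s := mul_sub_le_huber hv hb
  · linarith [mul_sub_le_huber (s := s) hv (b := 1 / 3) le_rfl, le_max_right (√(v * L)) L]

end Huber

section Potential

/-- The derivative in `S` of the potential `Ψ(S, v)` with `G₀ = 1`. -/
def potentialDeriv (ε v s : ℝ) : ℝ := alpha ε 1 v * (Real.exp (huber v s) * huberSlope v s)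

/-- The primitive in `S`, vanishing at `0`, of the potential `Ψ(S, v)` with `G₀ = 1`. It is the
energy of the regret analysis. -/
def potentialPrimitive (ε v y : ℝ) : ℝ := ∫ s in 0..y, potential ε 1 s v

variable {ε v v' s t y : ℝ}

theorem alpha_one (ε v : ℝ) : alpha ε 1 v = ε / (√v * Real.log v ^ 2) := by simp [alpha]

theorem alpha_one_pos (hε : 0 < ε) (hv : 1 < v) : 0 < alpha ε 1 v := by
  have := Real.log_pos hv
  rw [alpha_one]
  positivity

theorem potential_one (ε s : ℝ) (hv : 0 < v) :
    potential ε 1 s v = alpha ε 1 v * (Real.exp (huber v s) - 1) := by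
  unfold potential
  split_ifs with h
  · rw [huber_of_le hv (by simpa using h)]
  · rw [huber_of_ge hv (by simpa using (not_le.1 h).le)]
    simp

theorem potential_one_zero (ε : ℝ) (hv : 0 < v) : potential ε 1 0 v = 0 := by
  simp [potential_one _ _ hv, huber_zero hv]

theorem potential_one_nonneg (hε : 0 < ε) (hv : 1 < v) (s : ℝ) : 0 ≤ potential ε 1 s v := by
  have hv0 := one_pos.trans hv
  rw [potential_one _ _ hv0]
  exact mul_nonneg (alpha_one_pos hε hv).le (sub_nonneg.2 (Real.one_le_exp (huber_nonneg hv0)))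

theorem hasDerivAt_potential_one (ε : ℝ) (hv : 0 < v) (s : ℝ) :
    HasDerivAt (fun s => potential ε 1 s v) (potentialDeriv ε v s) s := by
  simp only [potential_one ε _ hv]
  exact (((hasDerivAt_huber hv s).exp).sub_const 1).const_mul _

theorem continuous_potential_one (ε : ℝ) (hv : 0 < v) : Continuous fun s => potential ε 1 s v :=
  continuous_iff_continuousAt.2 fun s => (hasDerivAt_potential_one ε hv s).continuousAt

theorem potentialDeriv_mono (hε : 0 < ε) (hv : 1 < v) (hs : 0 ≤ s) (h : s ≤ t) :
    potentialDeriv ε v s ≤ potentialDeriv ε v t := by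
  have hv0 := one_pos.trans hv
  unfold potentialDeriv
  gcongr
  · exact (alpha_one_pos hε hv).le
  · exact huberSlope_nonneg hv0 hs
  · exact huber_mono hv0 hs h
  · exact huberSlope_mono hv0 h

theorem hasDerivAt_potentialPrimitive (ε : ℝ) (hv : 0 < v) (y : ℝ) :
    HasDerivAt (potentialPrimitive ε v) (potential ε 1 y v) y :=
  (continuous_potential_one ε hv).integral_hasStrictDerivAt 0 y |>.hasDerivAt

theorem potentialPrimitive_zero (ε v : ℝ) : potentialPrimitive ε v 0 = 0 :=
  intervalIntegral.integral_same

theorem potentialPrimitive_nonneg (hε : 0 < ε) (hv : 1 < v) (hy : 0 ≤ y) :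
    0 ≤ potentialPrimitive ε v y :=
  intervalIntegral.integral_nonneg hy fun s _ => potential_one_nonneg hε hv s

theorem mul_sub_potentialPrimitive_le {r S : ℝ} (hε : 0 < ε) (hv : 1 < v) (hr : 0 ≤ r)
    (hS : 0 ≤ S) :
    S * r - potentialPrimitive ε v S ≤ 6 * r *
      max (√(v * Real.log (r / alpha ε 1 v + 1))) (Real.log (r / alpha ε 1 v + 1)) := by
  have hv0 := one_pos.trans hv
  have hα := alpha_one_pos hε hv
  have hdiv : 0 ≤ r / alpha ε 1 v := by positivity
  set L := Real.log (r / alpha ε 1 v + 1)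
  have hL : 0 ≤ L := Real.log_nonneg (by linarith)
  set M := max (√(v * L)) L
  have hM : 0 ≤ 6 * M := by linarith [hL.trans (le_max_right (√(v * L)) L)]
  have le_potential : ∀ s, 6 * M ≤ s → r ≤ potential ε 1 s v := fun s hs => by
    calc r = alpha ε 1 v * (Real.exp L - 1) := by
          rw [Real.exp_log (by linarith)]
          field_simp
          ring
      _ ≤ alpha ε 1 v * (Real.exp (huber v s) - 1) := by
          gcongr
          exact le_huber_of_six_mul_max_le hv0 hL hs
      _ = potential ε 1 s v := (potential_one _ _ hv0).symm
  rcases le_total S (6 * M) with h | h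
  · linarith [potentialPrimitive_nonneg hε hv hS, mul_le_mul_of_nonneg_right h hr]
  · have := sub_le_sub_of_hasDerivAt_le h (fun s _ => (hasDerivAt_id s).const_mul r)
      (fun s _ => hasDerivAt_potentialPrimitive ε hv0 s)
      fun s hs => by simpa using le_potential s hs.1.le
    simp only [id] at this
    linarith [potentialPrimitive_nonneg hε hv hM]

end Potential

section Scale

variable {ε v v' c s y : ℝ}

theorem alpha_one_mul_le_of_le (hε : 0 ≤ ε) (hv : 1 < v) (h : v ≤ v') :
    alpha ε 1 v' * (1 + (v' - v) / (2 * v')) ≤ alpha ε 1 v := by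
  have hv0 := one_pos.trans hv
  have hv'0 := hv0.trans_le h
  have hlog := Real.log_pos hv
  have hlog' := Real.log_pos (hv.trans_le h)
  set u := (v' - v) / v' with hu
  have hu0 : 0 ≤ u := div_nonneg (sub_nonneg.2 h) hv'0.le
  have hvu : v = v' * (1 - u) := by rw [hu]; field_simp; ring
  have hsqrt : (1 + u / 2) * √v ≤ √v' := by
    refine Real.le_sqrt_of_sq_le ?_
    rw [mul_pow, Real.sq_sqrt hv0.le]
    calc (1 + u / 2) ^ 2 * v = v' * (1 - (3 / 4 * u ^ 2 + u ^ 3 / 4)) := by rw [hvu]; ring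
      _ ≤ v' := mul_le_of_le_one_right hv'0.le (by linarith [pow_nonneg hu0 2, pow_nonneg hu0 3])
  rw [show (v' - v) / (2 * v') = u / 2 by rw [hu]; field_simp, alpha_one, alpha_one,
    div_mul_eq_mul_div, div_le_div_iff₀ (by positivity) (by positivity)]
  calc ε * (1 + u / 2) * (√v * Real.log v ^ 2)
      = ε * ((1 + u / 2) * √v * Real.log v ^ 2) := by ring
    _ ≤ ε * (√v' * Real.log v' ^ 2) := by gcongr

theorem alpha_one_le_pow_mul (hε : 0 ≤ ε) (hc : 1 ≤ c) (hv : Real.exp 1 ≤ v) (hv' : 1 < v')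
    (h : v' ≤ c * v) : alpha ε 1 v ≤ c ^ 3 * alpha ε 1 v' := by
  have hv0 : 0 < v := (Real.exp_pos 1).trans_le hv
  have hlog : 1 ≤ Real.log v := (Real.le_log_iff_exp_le hv0).2 hv
  have hlog' : Real.log v' ≤ c * Real.log v :=
    calc Real.log v' ≤ Real.log (c * v) := Real.log_le_log (by linarith) h
      _ = Real.log c + Real.log v := Real.log_mul (by linarith) hv0.ne'
      _ ≤ (c - 1) * Real.log v + Real.log v := by
          gcongr
          exact (Real.log_le_sub_one_of_pos (by linarith)).trans
            (le_mul_of_one_le_right (by linarith) hlog)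
      _ = c * Real.log v := by ring
  have hsqrt : √v' ≤ c * √v := by
    rw [Real.sqrt_le_left (by positivity), mul_pow, Real.sq_sqrt hv0.le]
    nlinarith [mul_le_mul_of_nonneg_right hc (mul_nonneg (zero_le_one.trans hc) hv0.le)]
  have hlog'0 := Real.log_pos hv'
  rw [alpha_one, alpha_one, ← mul_div_assoc, div_le_div_iff₀ (by positivity) (by positivity)]
  calc ε * (√v' * Real.log v' ^ 2) ≤ ε * ((c * √v) * (c * Real.log v) ^ 2) := by gcongr
    _ = c ^ 3 * ε * (√v * Real.log v ^ 2) := by ring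

theorem exp_huber_mul_le (hv : 0 < v) :
    Real.exp (huber v' s) * (1 + 9 * huberSlope v' s ^ 2 * (v' - v)) ≤ Real.exp (huber v s) :=
  calc Real.exp (huber v' s) * (1 + 9 * huberSlope v' s ^ 2 * (v' - v))
      ≤ Real.exp (huber v' s) * Real.exp (9 * huberSlope v' s ^ 2 * (v' - v)) := by
        gcongr
        linarith [Real.add_one_le_exp (9 * huberSlope v' s ^ 2 * (v' - v))]
    _ = Real.exp (huber v' s + 9 * huberSlope v' s ^ 2 * (v' - v)) := (Real.exp_add _ _).symm
    _ ≤ Real.exp (huber v s) := Real.exp_le_exp.2 (huber_add_mul_scale_sub_le hv)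

/-- The rate at which the potential `Ψ(s, v)` with `G₀ = 1` decreases in `v`, relative to
`alpha ε 1 v`, as accounted for by `√v` and by the exponent; the growth of the logarithm is not
counted. -/
def scaleDecay (v s : ℝ) : ℝ :=
  (Real.exp (huber v s) - 1) / (2 * v) + 9 * huberSlope v s ^ 2 * Real.exp (huber v s)

theorem continuous_scaleDecay (hv : 0 < v) : Continuous (scaleDecay v) := by
  have hhuber : Continuous (huber v) :=
    continuous_iff_continuousAt.2 fun s => (hasDerivAt_huber hv s).continuousAt
  have hslope := continuous_huberSlope v
  unfold scaleDecay
  fun_prop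

theorem potential_one_add_scaleDecay_le (hε : 0 < ε) (hv : 1 < v) (h : v ≤ v') :
    potential ε 1 s v' + (v' - v) * alpha ε 1 v' * scaleDecay v' s ≤ potential ε 1 s v := by
  have hv0 := one_pos.trans hv
  have hv'0 := hv0.trans_le h
  have hα' := alpha_one_pos hε (hv.trans_le h)
  have hE : 1 ≤ Real.exp (huber v' s) := Real.one_le_exp (huber_nonneg hv'0)
  set E := Real.exp (huber v' s)
  set p := (v' - v) / (2 * v') with hp
  set q := 9 * huberSlope v' s ^ 2 * (v' - v)
  have hp0 : 0 ≤ p := div_nonneg (sub_nonneg.2 h) (by positivity)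
  have hq0 : 0 ≤ q := mul_nonneg (by positivity) (sub_nonneg.2 h)
  have hEq : 0 ≤ E * q := mul_nonneg (by positivity) hq0
  rw [potential_one _ _ hv0, potential_one _ _ hv'0]
  calc alpha ε 1 v' * (E - 1) + (v' - v) * alpha ε 1 v' * scaleDecay v' s
      = alpha ε 1 v' * ((1 + p) * (E - 1) + E * q) := by
        simp only [scaleDecay, hp, E, q]
        ring
    _ ≤ alpha ε 1 v' * ((1 + p) * (E * (1 + q) - 1)) := by
        gcongr
        linarith [mul_nonneg hp0 hEq]
    _ = alpha ε 1 v' * (1 + p) * (E * (1 + q) - 1) := by ring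
    _ ≤ alpha ε 1 v * (Real.exp (huber v s) - 1) :=
        mul_le_mul (alpha_one_mul_le_of_le hε.le hv h)
          (sub_le_sub_right (exp_huber_mul_le hv0) 1) (by linarith)
          (alpha_one_pos hε hv).le

theorem nine_mul_huberSlope_mul_le_integral_scaleDecay (hv : 0 < v) (hy : 0 ≤ y) :
    9 * huberSlope v y * (Real.exp (huber v y) - 1) ≤ ∫ s in 0..y, scaleDecay v s := by
  have hI : ∀ s, HasDerivAt (fun y => ∫ s in 0..y, scaleDecay v s) (scaleDecay v s) s := fun s =>
    ((continuous_scaleDecay hv).integral_hasStrictDerivAt 0 s).hasDerivAt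
  have hE : ∀ s, HasDerivAt (fun s => Real.exp (huber v s) - 1)
      (Real.exp (huber v s) * huberSlope v s) s := fun s =>
    ((hasDerivAt_huber hv s).exp).sub_const 1
  have quadratic : ∀ y, 0 ≤ y → y ≤ 6 * v →
      9 * huberSlope v y * (Real.exp (huber v y) - 1) ≤ ∫ s in 0..y, scaleDecay v s := by
    intro y hy hy6
    have := sub_le_sub_of_hasDerivAt_le hy
      (fun s _ => (((hasDerivAt_id s).div_const (18 * v)).const_mul 9).mul (hE s))
      (fun s _ => hI s) fun s hs => by
        rw [scaleDecay, huberSlope_of_le hv (hs.2.le.trans hy6)]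
        simp only [id]
        exact le_of_eq (by ring)
    simpa [huber_zero hv, huberSlope_of_le hv hy6] using this
  rcases le_total y (6 * v) with h6 | h6
  · exact quadratic y hy h6
  · have threshold := quadratic (6 * v) (by positivity) le_rfl
    have affine := sub_le_sub_of_hasDerivAt_le h6 (fun s _ => (hE s).const_mul (9 * (1 / 3)))
      (fun s _ => hI s) fun s hs => by
        have : 0 ≤ (Real.exp (huber v s) - 1) / (2 * v) :=
          div_nonneg (sub_nonneg.2 (Real.one_le_exp (huber_nonneg hv))) (by positivity)
        rw [scaleDecay, huberSlope_of_ge hv hs.1.le]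
        linarith
    rw [huberSlope_of_ge hv le_rfl] at threshold
    rw [huberSlope_of_ge hv h6]
    linarith

theorem potentialPrimitive_add_le_of_le (hε : 0 < ε) (hv : 1 < v) (h : v ≤ v') (hy : 0 ≤ y) :
    potentialPrimitive ε v' y + (v' - v) * alpha ε 1 v' *
      (9 * huberSlope v' y * (Real.exp (huber v' y) - 1)) ≤ potentialPrimitive ε v y := by
  have hv0 := one_pos.trans hv
  have hv'0 := hv0.trans_le h
  have hκ : 0 ≤ (v' - v) * alpha ε 1 v' :=
    mul_nonneg (sub_nonneg.2 h) (alpha_one_pos hε (hv.trans_le h)).le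
  have hΨ' := (continuous_potential_one ε hv'0).intervalIntegrable (μ := MeasureTheory.volume) 0 y
  have hdecay := ((continuous_scaleDecay hv'0).const_mul
    ((v' - v) * alpha ε 1 v')).intervalIntegrable (μ := MeasureTheory.volume) 0 y
  calc potentialPrimitive ε v' y + (v' - v) * alpha ε 1 v' *
        (9 * huberSlope v' y * (Real.exp (huber v' y) - 1))
      ≤ potentialPrimitive ε v' y + (v' - v) * alpha ε 1 v' * ∫ s in 0..y, scaleDecay v' s := by
        gcongr
        exact nine_mul_huberSlope_mul_le_integral_scaleDecay hv'0 hy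
    _ = ∫ s in 0..y, (potential ε 1 s v' + (v' - v) * alpha ε 1 v' * scaleDecay v' s) := by
        rw [intervalIntegral.integral_add hΨ' hdecay, intervalIntegral.integral_const_mul,
          potentialPrimitive]
    _ ≤ potentialPrimitive ε v y :=
        intervalIntegral.integral_mono_on hy (hΨ'.add hdecay)
          ((continuous_potential_one ε hv0).intervalIntegrable 0 y)
          fun s _ => potential_one_add_scaleDecay_le hε hv h

end Scale

section Step

variable {ε v v' c y m : ℝ}

theorem huberSlope_le_mul_of_le (hv : 0 < v) (hv' : 0 < v') (hc : 1 ≤ c) (h : v' ≤ c * v)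
    (hy : 0 ≤ y) : huberSlope v y ≤ c * huberSlope v' y := by
  rw [huberSlope, huberSlope, mul_min_of_nonneg _ _ (zero_le_one.trans hc)]
  refine min_le_min ?_ (by linarith)
  rw [mul_div_assoc', div_le_div_iff₀ (by positivity) (by positivity)]
  linarith [mul_le_mul_of_nonneg_left h hy]

theorem exp_huber_le_four_mul_of_le_add_one (hv : 0 < v) (hv' : 0 < v') (hvv' : v' ≤ v + 1)
    (hy : 0 ≤ y) (hym : y ≤ m) (hmy : m ≤ y + 1) :
    Real.exp (huber v m) ≤ 4 * Real.exp (huber v' y) := by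
  have exp_le : Real.exp (4 / 3) ≤ 4 := by
    refine le_of_pow_le_pow_left₀ three_ne_zero (by norm_num) ?_
    calc Real.exp (4 / 3) ^ 3 = Real.exp 1 ^ 4 := by
          rw [← Real.exp_nat_mul, ← Real.exp_nat_mul]
          norm_num
      _ ≤ 2.72 ^ 4 := by
          gcongr
          linarith [Real.exp_one_lt_d9]
      _ ≤ 4 ^ 3 := by norm_num
  have hshift : huber v m ≤ huber v y + 1 / 3 := by
    have := huber_add_slope_mul_le (s := m) (t := y) hv
    nlinarith [huberSlope_le (v := v) (s := m), huberSlope_nonneg hv (hy.trans hym)]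
  have hscale : huber v y ≤ huber v' y + 1 := by
    have hsq : huberSlope v y ^ 2 ≤ 1 / 9 :=
      (pow_le_pow_left₀ (huberSlope_nonneg hv hy) huberSlope_le 2).trans (by norm_num)
    have := huber_add_mul_scale_sub_le (v := v') (v' := v) (s := y) hv'
    nlinarith [sq_nonneg (huberSlope v y)]
  calc Real.exp (huber v m) ≤ Real.exp (4 / 3 + huber v' y) := by
        gcongr
        linarith
    _ = Real.exp (4 / 3) * Real.exp (huber v' y) := Real.exp_add _ _
    _ ≤ 4 * Real.exp (huber v' y) := by gcongr

theorem half_potentialDeriv_le (hε : 0 < ε) (hv : 4 ≤ v) (hvv' : v ≤ v') (hv' : v' ≤ v + 1)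
    (hy : 0 ≤ y) (hym : y ≤ m) (hmy : m ≤ y + 1) :
    potentialDeriv ε v m / 2 ≤
      alpha ε 1 v' * (5 * Real.exp (huber v' y) * (huberSlope v' y + 1 / (18 * v'))) := by
  have hv0 : 0 < v := by linarith
  have hv'0 : 0 < v' := by linarith
  have hα' := alpha_one_pos hε (show 1 < v' by linarith)
  have hratio : v' ≤ 5 / 4 * v := by linarith
  have hα : alpha ε 1 v ≤ (5 / 4) ^ 3 * alpha ε 1 v' :=
    alpha_one_le_pow_mul hε.le (by norm_num) (by linarith [Real.exp_one_lt_d9]) (by linarith)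
      hratio
  have hE := exp_huber_le_four_mul_of_le_add_one hv0 hv'0 hv' hy hym hmy
  have hslope : huberSlope v m ≤ 5 / 4 * (huberSlope v' y + 1 / (18 * v')) := by
    refine (huberSlope_le_mul_of_le hv0 hv'0 (by norm_num) hratio (hy.trans hym)).trans ?_
    refine mul_le_mul_of_nonneg_left ((huberSlope_le_add hv'0 hym).trans ?_) (by norm_num)
    gcongr
    linarith
  have hc' := huberSlope_nonneg hv'0 hy
  calc potentialDeriv ε v m / 2
      ≤ (5 / 4) ^ 3 * alpha ε 1 v' * (4 * Real.exp (huber v' y) *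
          (5 / 4 * (huberSlope v' y + 1 / (18 * v')))) / 2 := by
        unfold potentialDeriv
        have := huberSlope_nonneg hv0 (hy.trans hym)
        gcongr
    _ = 625 / 128 *
          (alpha ε 1 v' * (Real.exp (huber v' y) * (huberSlope v' y + 1 / (18 * v')))) := by ring
    _ ≤ 5 * (alpha ε 1 v' * (Real.exp (huber v' y) * (huberSlope v' y + 1 / (18 * v')))) := by
        gcongr
        norm_num
    _ = _ := by ring

theorem exp_huber_le_three (hv : 4 ≤ v) (hy : 0 ≤ y) (h : huberSlope v y ≤ 5 / (72 * v)) :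
    Real.exp (huber v y) ≤ 3 := by
  have hv0 : 0 < v := by linarith
  have hy : y ≤ 5 / 4 := by
    rcases le_total y (6 * v) with hy6 | hy6
    · rw [huberSlope_of_le hv0 hy6, div_le_div_iff₀ (by positivity) (by positivity)] at h
      nlinarith
    · rw [huberSlope_of_ge hv0 hy6, div_le_div_iff₀ (by positivity) (by positivity)] at h
      linarith
  have : huber v y ≤ 1 := by
    rw [huber_of_le hv0 (by linarith), div_le_one (by positivity)]
    nlinarith
  linarith [Real.exp_le_exp.2 this, Real.exp_one_lt_d9]

theorem mul_sub_add_le_four_div {E r : ℝ} (hr : 2 ≤ r) (hc : 0 ≤ c)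
    (hE : 1 + 9 * r ^ 2 * c ^ 2 ≤ E) (hE3 : c ≤ 5 / (72 * r ^ 2) → E ≤ 3) :
    E * (5 / (18 * r ^ 2) - 4 * c) + 9 * c ≤ 4 / r := by
  have hinv : 1 / r ≤ 1 / 2 := one_div_le_one_div_of_le two_pos hr
  rcases le_total c (5 / (72 * r ^ 2)) with hsmall | hlarge
  · have h5 : 4 * c ≤ 5 / (18 * r ^ 2) := by linear_combination 4 * hsmall
    calc E * (5 / (18 * r ^ 2) - 4 * c) + 9 * c
        ≤ 3 * (5 / (18 * r ^ 2) - 4 * c) + 9 * c := by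
          gcongr
          exact hE3 hsmall
      _ = 15 / 18 * (1 / r) * (1 / r) - 3 * c := by field
      _ ≤ 15 / 18 * (1 / 2) * (1 / r) := by
          have : 15 / 18 * (1 / r) * (1 / r) ≤ 15 / 18 * (1 / 2) * (1 / r) := by gcongr
          linarith
      _ ≤ 4 * (1 / r) := by gcongr; norm_num
      _ = 4 / r := by ring
  · have h5 : 5 / (18 * r ^ 2) ≤ 4 * c := by linear_combination 4 * hlarge
    have hcubic : (1 + 9 * (r * c) ^ 2) * (5 / 36 - 4 * (r * c)) + 9 * (r * c) ≤ 4 := by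
      have : 0 ≤ r * c := by positivity
      nlinarith [mul_nonneg this (sq_nonneg (r * c - 1 / 4)), sq_nonneg (r * c - 1 / 4)]
    calc E * (5 / (18 * r ^ 2) - 4 * c) + 9 * c
        ≤ (1 + 9 * r ^ 2 * c ^ 2) * (5 / (18 * r ^ 2) - 4 * c) + 9 * c := by
          linear_combination mul_le_mul_of_nonpos_right hE (sub_nonpos.2 h5)
      _ = ((1 + 9 * (r * c) ^ 2) * (5 / 18 * (1 / r) - 4 * (r * c)) + 9 * (r * c)) / r := by
          field
      _ ≤ ((1 + 9 * (r * c) ^ 2) * (5 / 18 * (1 / 2) - 4 * (r * c)) + 9 * (r * c)) / r := by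
          gcongr
      _ ≤ 4 / r := by
          gcongr
          linarith

theorem exp_huber_mul_slope_le (hv : 4 ≤ v) (hy : 0 ≤ y) :
    5 * Real.exp (huber v y) * (huberSlope v y + 1 / (18 * v)) ≤
      9 * huberSlope v y * (Real.exp (huber v y) - 1) + 4 / √v := by
  have hv0 : 0 < v := by linarith
  have hsq : √v ^ 2 = v := Real.sq_sqrt hv0.le
  have hE : 1 + 9 * v * huberSlope v y ^ 2 ≤ Real.exp (huber v y) := by
    linarith [Real.add_one_le_exp (huber v y), nine_mul_sq_le_huber hv0 hy]
  have hr : 2 ≤ √v := Real.le_sqrt_of_sq_le (by linarith)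
  have := mul_sub_add_le_four_div (E := Real.exp (huber v y)) hr (huberSlope_nonneg hv0 hy)
    (by rwa [hsq]) (by rw [hsq]; exact exp_huber_le_three hv hy)
  rw [hsq] at this
  linear_combination this

theorem alpha_one_div_sqrt_mul_sub_le (hε : 0 ≤ ε) (hv : 1 < v) (h : v ≤ v') :
    alpha ε 1 v' / √v' * (v' - v) ≤ ε * (1 / Real.log v - 1 / Real.log v') := by
  have hv0 := one_pos.trans hv
  have hv'0 := hv0.trans_le h
  have hlog := Real.log_pos hv
  have hlogs : Real.log v ≤ Real.log v' := Real.log_le_log hv0 h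
  have hlog' := hlog.trans_le hlogs
  have hdiff : (v' - v) / v' ≤ Real.log v' - Real.log v := by
    rw [← Real.log_div hv'0.ne' hv0.ne', sub_div, div_self hv'0.ne', ← inv_div v' v]
    exact Real.one_sub_inv_le_log_of_pos (by positivity)
  calc alpha ε 1 v' / √v' * (v' - v) = ε * ((v' - v) / v' / (Real.log v' * Real.log v')) := by
        rw [alpha_one]
        field_simp
        rw [Real.sq_sqrt hv'0.le]
    _ ≤ ε * ((Real.log v' - Real.log v) / (Real.log v * Real.log v')) := by
        gcongr
    _ = ε * (1 / Real.log v - 1 / Real.log v') := by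
        field_simp

theorem potentialPrimitive_norm_add_le {E : Type*} [NormedAddCommGroup E] [InnerProductSpace ℝ E]
    (hε : 0 < ε) (hv : 4 ≤ v) (θ : E) {z : E} (hz : ‖z‖ ≤ 1) :
    potentialPrimitive ε (v + ‖z‖ ^ 2) ‖θ + z‖ ≤
      potentialPrimitive ε v ‖θ‖ + potential ε 1 ‖θ‖ v / ‖θ‖ * inner ℝ θ z +
        4 * ε * (1 / Real.log v - 1 / Real.log (v + ‖z‖ ^ 2)) := by
  have hv1 : 1 < v := by linarith
  have hv0 : 0 < v := by linarith
  have hz2 : ‖z‖ ^ 2 ≤ 1 := pow_le_one₀ (norm_nonneg z) hz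
  have hvv' : v ≤ v + ‖z‖ ^ 2 := le_add_of_nonneg_right (sq_nonneg _)
  set v' := v + ‖z‖ ^ 2 with hv'
  set y := ‖θ + z‖
  set m := max ‖θ‖ y
  have hmy : m ≤ y + 1 :=
    max_le (by linarith [norm_le_norm_add_norm_sub' θ (θ + z), show ‖θ - (θ + z)‖ = ‖z‖ by simp])
      (by linarith)
  have expansion : potentialPrimitive ε v y ≤ potentialPrimitive ε v ‖θ‖ +
      potential ε 1 ‖θ‖ v / ‖θ‖ * inner ℝ θ z + potentialDeriv ε v m / 2 * ‖z‖ ^ 2 :=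
    radial_le_add_inner_add_sq (fun s _ => hasDerivAt_potentialPrimitive ε hv0 s)
      (fun s _ => hasDerivAt_potential_one ε hv0 s)
      (fun s hs => potentialDeriv_mono hε hv1 hs.1 hs.2) (potential_one_zero ε hv0)
      (le_max_left _ _) (le_max_right _ _)
  have growth := potentialPrimitive_add_le_of_le hε hv1 hvv' (norm_nonneg (θ + z))
  have telescope := alpha_one_div_sqrt_mul_sub_le hε.le hv1 hvv'
  have curvature : potentialDeriv ε v m / 2 * ‖z‖ ^ 2 ≤ alpha ε 1 v' *
      (9 * huberSlope v' y * (Real.exp (huber v' y) - 1) + 4 / √v') * ‖z‖ ^ 2 := by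
    gcongr
    exact (half_potentialDeriv_le hε hv hvv' (by linarith) (norm_nonneg _) (le_max_right _ _)
      hmy).trans (mul_le_mul_of_nonneg_left (exp_huber_mul_slope_le (hv.trans hvv') (norm_nonneg _))
        (alpha_one_pos hε (hv1.trans_le hvv')).le)
  rw [show v' - v = ‖z‖ ^ 2 by simp [hv']] at growth telescope
  linear_combination expansion + growth + curvature + 4 * telescope

end Step

section Learner

variable {E : Type*} [NormedAddCommGroup E]

/-- The parameter `V_t` of the potential when the gradients `z₁, …, z_{t-1}` have been received. -/
def scale (G₀ : ℝ) (z : ℕ → E) (t : ℕ) : ℝ := 4 * G₀ ^ 2 + ∑ s ∈ Finset.Ico 1 t, ‖z s‖ ^ 2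

/-- The parameter-free learner for linear losses with gradients `z₁, z₂, …` in an inner product
space. The operators underlying the kernelized algorithm are its iterates in the space of
Hilbert-Schmidt operators. -/
def paramFreeIterate [NormedSpace ℝ E] (ε G₀ : ℝ) (z : ℕ → E) (t : ℕ) : E :=
  (potential ε G₀ ‖∑ s ∈ Finset.Ico 1 t, z s‖ (scale G₀ z t) / ‖∑ s ∈ Finset.Ico 1 t, z s‖) •
    (-∑ s ∈ Finset.Ico 1 t, z s)

/-- The regret bound against a comparator of norm `r` when the final scale is `V`. -/
def regretBound (ε G₀ V r : ℝ) : ℝ :=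
  4 * G₀ * ε + 6 * r * max (√(V * Real.log (r / alpha ε G₀ V + 1)))
    (G₀ * Real.log (r / alpha ε G₀ V + 1))

theorem scale_succ (G₀ : ℝ) (z : ℕ → E) (n : ℕ) :
    scale G₀ z (n + 1 + 1) = scale G₀ z (n + 1) + ‖z (n + 1)‖ ^ 2 := by
  rw [scale, scale, Finset.sum_Ico_succ_top (by lia), add_assoc]

theorem four_le_scale_one (z : ℕ → E) (t : ℕ) : 4 ≤ scale 1 z t := by
  have := Finset.sum_nonneg fun s (_ : s ∈ Finset.Ico 1 t) => sq_nonneg ‖z s‖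
  rw [scale]
  linarith

variable {c : ℝ}

theorem alpha_mul (ε : ℝ) (hc : 0 < c) (V : ℝ) : alpha ε c (c ^ 2 * V) = alpha ε 1 V := by
  rw [alpha, alpha_one, Real.sqrt_mul (sq_nonneg c), Real.sqrt_sq hc.le,
    mul_div_cancel_left₀ _ (pow_ne_zero 2 hc.ne'), mul_comm ε, mul_assoc c,
    mul_div_mul_left _ _ hc.ne']

theorem potential_mul (ε : ℝ) (hc : 0 < c) (S V : ℝ) :
    potential ε c (c * S) (c ^ 2 * V) = potential ε 1 S V := by
  have hcond : c * S ≤ 6 * (c ^ 2 * V) / c ↔ S ≤ 6 * V / 1 := by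
    rw [div_one, show 6 * (c ^ 2 * V) / c = c * (6 * V) by field, mul_le_mul_iff_right₀ hc]
  simp only [potential, hcond, alpha_mul ε hc]
  rw [show (c * S) ^ 2 / (36 * (c ^ 2 * V)) = S ^ 2 / (36 * V) by
      rw [mul_pow, mul_left_comm, mul_div_mul_left _ _ (pow_ne_zero 2 hc.ne')],
    show c * S / (3 * c) - c ^ 2 * V / c ^ 2 = S / (3 * 1) - V / 1 ^ 2 by field]

theorem regretBound_mul (ε : ℝ) (hc : 0 < c) (V r : ℝ) :
    regretBound ε c (c ^ 2 * V) r = c * regretBound ε 1 V r := by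
  simp only [regretBound, alpha_mul ε hc]
  rw [mul_assoc (c ^ 2), Real.sqrt_mul (sq_nonneg c), Real.sqrt_sq hc.le,
    ← mul_max_of_nonneg _ _ hc.le, one_mul]
  ring

theorem scale_smul [NormedSpace ℝ E] (c : ℝ) (z : ℕ → E) (t : ℕ) :
    scale c (c • z) t = c ^ 2 * scale 1 z t := by
  simp only [scale, Pi.smul_apply, norm_smul, mul_pow, Real.norm_eq_abs, sq_abs, Finset.mul_sum,
    mul_add]
  ring

theorem paramFreeIterate_smul [NormedSpace ℝ E] (ε : ℝ) (hc : 0 < c) (z : ℕ → E)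
    (t : ℕ) : paramFreeIterate ε c (c • z) t = paramFreeIterate ε 1 z t := by
  simp only [paramFreeIterate, scale_smul, Pi.smul_apply, ← Finset.smul_sum, norm_smul,
    Real.norm_of_nonneg hc.le, potential_mul ε hc, ← smul_neg, smul_smul]
  rw [div_mul_eq_mul_div, mul_comm _ c, mul_div_mul_left _ _ hc.ne']

end Learner

section Regret

variable {E : Type*} [NormedAddCommGroup E] [InnerProductSpace ℝ E] {ε G₀ : ℝ} {z : ℕ → E}
  {n T : ℕ}

theorem potentialPrimitive_add_sum_inner_le (hε : 0 < ε)
    (hz : ∀ t ∈ Finset.Icc 1 n, ‖z t‖ ≤ 1) :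
    potentialPrimitive ε (scale 1 z (n + 1)) ‖∑ s ∈ Finset.Ico 1 (n + 1), z s‖ +
        ∑ t ∈ Finset.Icc 1 n, inner ℝ (z t) (paramFreeIterate ε 1 z t) ≤
      4 * ε * (1 / Real.log 4 - 1 / Real.log (scale 1 z (n + 1))) := by
  induction n with
  | zero => simp [scale, potentialPrimitive_zero]
  | succ n ih =>
    have ih := ih fun t ht => hz t (Finset.Icc_subset_Icc_right n.le_succ ht)
    have step := potentialPrimitive_norm_add_le hε (four_le_scale_one z (n + 1))
      (∑ s ∈ Finset.Ico 1 (n + 1), z s) (hz (n + 1) (Finset.mem_Icc.2 ⟨by lia, le_rfl⟩))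
    rw [← scale_succ, ← Finset.sum_Ico_succ_top (by lia)] at step
    rw [Finset.sum_Icc_succ_top (by lia), paramFreeIterate, inner_smul_right, inner_neg_right,
      real_inner_comm]
    linarith

theorem sum_inner_paramFreeIterate_one_sub_le (hε : 0 < ε) (hz : ∀ t ∈ Finset.Icc 1 T, ‖z t‖ ≤ 1)
    (u : E) :
    ∑ t ∈ Finset.Icc 1 T, inner ℝ (z t) (paramFreeIterate ε 1 z t - u) ≤
      regretBound ε 1 (scale 1 z (T + 1)) ‖u‖ := by
  have hv : 1 < scale 1 z (T + 1) := by linarith [four_le_scale_one z (T + 1)]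
  have energy := potentialPrimitive_add_sum_inner_le hε hz
  have fenchel := mul_sub_potentialPrimitive_le hε hv (norm_nonneg u)
    (norm_nonneg (∑ s ∈ Finset.Ico 1 (T + 1), z s))
  have comparator : -∑ t ∈ Finset.Icc 1 T, inner ℝ (z t) u ≤
      ‖∑ s ∈ Finset.Ico 1 (T + 1), z s‖ * ‖u‖ := by
    rw [← sum_inner]
    exact (neg_le_abs _).trans (abs_real_inner_le_norm _ _)
  have hlog : 1 ≤ Real.log 4 :=
    (Real.le_log_iff_exp_le (by norm_num)).2 (by linarith [Real.exp_one_lt_d9])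
  have herror : 4 * ε * (1 / Real.log 4 - 1 / Real.log (scale 1 z (T + 1))) ≤ 4 * ε := by
    have := one_div_nonneg.2 (Real.log_pos hv).le
    have := (div_le_one (zero_lt_one.trans_le hlog)).2 hlog
    exact mul_le_of_le_one_right (by positivity) (by linarith)
  simp only [inner_sub_right, Finset.sum_sub_distrib, regretBound, mul_one, one_mul]
  linarith

theorem sum_inner_paramFreeIterate_sub_le (hε : 0 < ε) (hG₀ : 0 < G₀)
    (hz : ∀ t ∈ Finset.Icc 1 T, ‖z t‖ ≤ G₀) (u : E) :
    ∑ t ∈ Finset.Icc 1 T, inner ℝ (z t) (paramFreeIterate ε G₀ z t - u) ≤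
      regretBound ε G₀ (scale G₀ z (T + 1)) ‖u‖ := by
  obtain ⟨y, rfl⟩ : ∃ y, z = G₀ • y := ⟨G₀⁻¹ • z, (smul_inv_smul₀ hG₀.ne' z).symm⟩
  have hy : ∀ t ∈ Finset.Icc 1 T, ‖y t‖ ≤ 1 := fun t ht => by
    simpa [norm_smul, abs_of_pos hG₀, hG₀] using hz t ht
  simp only [paramFreeIterate_smul ε hG₀, scale_smul, regretBound_mul ε hG₀, Pi.smul_apply,
    real_inner_smul_left, ← Finset.mul_sum]
  exact mul_le_mul_of_nonneg_left (sum_inner_paramFreeIterate_one_sub_le hε hy u) hG₀.le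

end Regret

section HilbertSchmidt

open InnerProductSpace (rankOne)

variable {H : Type*} [NormedAddCommGroup H] [InnerProductSpace ℝ H] [CompleteSpace H]
  {F : Type*} [NormedAddCommGroup F] [InnerProductSpace ℝ F]

theorem hsNorm_nonneg (A : H →L[ℝ] F) : 0 ≤ hsNorm A := Real.sqrt_nonneg _

variable [FiniteDimensional ℝ F]

/-- The isometric embedding of the operators `H →L[ℝ] F`, with the Hilbert-Schmidt norm, into a
power of `H`: the images of an orthonormal basis of `F` under the adjoint. -/
def hsEmbed : (H →L[ℝ] F) →ₗ[ℝ] PiLp 2 (fun _ : Fin (Module.finrank ℝ F) => H) where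
  toFun A := WithLp.toLp 2 fun j => ContinuousLinearMap.adjoint A (stdOrthonormalBasis ℝ F j)
  map_add' A B := by ext j; simp
  map_smul' c A := by ext j; simp

@[simp] theorem hsEmbed_apply (A : H →L[ℝ] F) (j : Fin (Module.finrank ℝ F)) :
    hsEmbed A j = ContinuousLinearMap.adjoint A (stdOrthonormalBasis ℝ F j) := rfl

theorem norm_hsEmbed (A : H →L[ℝ] F) : ‖hsEmbed A‖ = hsNorm A := by
  have h := (hasSum_hsNorm_sq A (exists_hilbertBasis ℝ H).choose_spec.choose).unique
    (hasSum_norm_sq_hilbertBasis A _)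
  rw [← sq_eq_sq₀ (norm_nonneg _) (hsNorm_nonneg A), h, PiLp.norm_sq_eq_of_L2]
  simp only [hsEmbed_apply]

theorem inner_hsEmbed_rankOne (g : F) (x : H) (A : H →L[ℝ] F) :
    inner ℝ (hsEmbed (rankOne ℝ g x)) (hsEmbed A) = inner ℝ g (A x) := by
  rw [PiLp.inner_apply, ← (stdOrthonormalBasis ℝ F).sum_inner_mul_inner g (A x)]
  refine Finset.sum_congr rfl fun j _ => ?_
  simp [inner_smul_left, ContinuousLinearMap.adjoint_inner_right, real_inner_comm]

theorem hsNorm_rankOne (g : F) (x : H) : hsNorm (rankOne ℝ g x) = ‖g‖ * ‖x‖ := by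
  rw [← sq_eq_sq₀ (hsNorm_nonneg _) (by positivity), ← norm_hsEmbed,
    ← real_inner_self_eq_norm_sq, inner_hsEmbed_rankOne]
  simp [inner_smul_right, mul_pow, mul_comm]

theorem hsEmbed_operatorIterate (φ : ℕ → H) (ε G₀ : ℝ) (g : ℕ → F) (t : ℕ) :
    hsEmbed (operatorIterate φ ε G₀ g t) =
      paramFreeIterate ε G₀ (fun s => hsEmbed (rankOne ℝ (g s) (φ s))) t := by
  simp only [operatorIterate, paramFreeIterate, scale, map_smul, map_neg, norm_hsEmbed, ← map_sum]

theorem sum_inner_operatorIterate_sub_le {ε G₀ : ℝ} (hε : 0 < ε) (hG₀ : 0 < G₀) {φ : ℕ → H}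
    {g : ℕ → F} {T : ℕ} (hg : ∀ t ∈ Finset.Icc 1 T, ‖g t‖ * ‖φ t‖ ≤ G₀) (U : H →L[ℝ] F) :
    ∑ t ∈ Finset.Icc 1 T, inner ℝ (g t) (operatorIterate φ ε G₀ g t (φ t) - U (φ t)) ≤
      regretBound ε G₀ (4 * G₀ ^ 2 + ∑ t ∈ Finset.Icc 1 T, ‖g t‖ ^ 2 * ‖φ t‖ ^ 2) (hsNorm U) := by
  have h := sum_inner_paramFreeIterate_sub_le (z := fun t => hsEmbed (rankOne ℝ (g t) (φ t))) hε
    hG₀ (fun t ht => by simpa only [norm_hsEmbed, hsNorm_rankOne] using hg t ht) (hsEmbed U)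
  simp only [← hsEmbed_operatorIterate, ← map_sub, inner_hsEmbed_rankOne, _root_.sub_apply, scale,
    norm_hsEmbed, hsNorm_rankOne, mul_pow] at h
  exact h

end HilbertSchmidt

section Algorithm

open InnerProductSpace (rankOne)

theorem mul_sqrt_le_liftedLipschitz (k : ℕ → ℕ → ℝ) {G : ℝ} (hG : 0 ≤ G) {T t : ℕ}
    (ht : t ∈ Finset.Icc 1 T) : G * √(k t t) ≤ liftedLipschitz k G T :=
  mul_le_mul_of_nonneg_left
    (le_ciSup (f := fun t : Finset.Icc 1 T => √(k t t)) (Set.finite_range _).bddAbove ⟨t, ht⟩) hG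

variable {F : Type*} [NormedAddCommGroup F]

theorem algV_succ (k : ℕ → ℕ → ℝ) (G₀ : ℝ) (g : ℕ → F) (t : ℕ) :
    algV k G₀ g (t + 1) = 4 * G₀ ^ 2 + ∑ s ∈ Finset.Ico 1 (t + 1), ‖g s‖ ^ 2 * k s s := by
  induction t with
  | zero => simp [algV]
  | succ t ih => rw [algV, ih, Finset.sum_Ico_succ_top t.succ_pos, add_assoc]

variable [InnerProductSpace ℝ F]

theorem norm_le_of_mem_subdifferential {f : F → ℝ} {G : ℝ≥0} (hf : LipschitzWith G f) {w g : F}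
    (hg : g ∈ subdifferential f w) : ‖g‖ ≤ G := by
  have hsub : ‖g‖ * ‖g‖ ≤ G * ‖g‖ :=
    calc ‖g‖ * ‖g‖ = inner ℝ g (w + g - w) := by
          rw [add_sub_cancel_left, real_inner_self_eq_norm_mul_norm]
      _ ≤ f (w + g) - f w := le_sub_iff_add_le'.2 (hg (w + g))
      _ ≤ dist (f (w + g)) (f w) := le_abs_self _
      _ ≤ G * dist (w + g) w := hf.dist_le_mul _ _
      _ = G * ‖g‖ := by rw [dist_self_add_left]
  rcases (norm_nonneg g).eq_or_lt with h | h
  · exact h ▸ G.2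
  · exact le_of_mul_le_mul_right hsub h

theorem norm_mul_sqrt_le_liftedLipschitz (k : ℕ → ℕ → ℝ) {f : F → ℝ} {G : ℝ≥0}
    (hf : LipschitzWith G f) {w g : F} (hg : g ∈ subdifferential f w) {T t : ℕ}
    (ht : t ∈ Finset.Icc 1 T) : ‖g‖ * √(k t t) ≤ liftedLipschitz k G T :=
  (mul_le_mul_of_nonneg_right (norm_le_of_mem_subdifferential hf hg) (Real.sqrt_nonneg _)).trans
    (mul_sqrt_le_liftedLipschitz k G.2 ht)

theorem dynamicRegret_le_sum_inner {T : ℕ} {ℓ : ℕ → F → ℝ} {g w : ℕ → F}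
    (hg : ∀ t ∈ Finset.Icc 1 T, g t ∈ subdifferential (ℓ t) (w t)) (u : ℕ → F) :
    dynamicRegret T ℓ w u ≤ ∑ t ∈ Finset.Icc 1 T, inner ℝ (g t) (w t - u t) :=
  Finset.sum_le_sum fun t ht => by
    have := hg t ht (u t)
    rw [← neg_sub (u t), inner_neg_right]
    linarith

variable {H : Type*} [NormedAddCommGroup H] [InnerProductSpace ℝ H] [CompleteSpace H]
  [FiniteDimensional ℝ F] {k : ℕ → ℕ → ℝ} {φ : ℕ → H}

theorem algSqS_succ (hk : ∀ s t, k s t = inner ℝ (φ s) (φ t)) (g : ℕ → F) (t : ℕ) :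
    algSqS k g (t + 1) = hsNorm (∑ s ∈ Finset.Ico 1 (t + 1), rankOne ℝ (g s) (φ s)) ^ 2 := by
  simp only [← norm_hsEmbed]
  induction t with
  | zero => simp [algSqS]
  | succ t ih =>
    have cross : inner ℝ (g (t + 1))
          ((∑ s ∈ Finset.Ico 1 (t + 1), rankOne ℝ (g s) (φ s)) (φ (t + 1))) =
        ∑ s ∈ Finset.Icc 1 t, k s (t + 1) * inner ℝ (g (t + 1)) (g s) := by
      simp only [_root_.sum_apply, inner_sum, InnerProductSpace.rankOne_apply, inner_smul_right,
        hk]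
      rfl
    rw [algSqS, ih, Finset.sum_Ico_succ_top t.succ_pos, map_add, norm_add_sq_real, real_inner_comm,
      inner_hsEmbed_rankOne, norm_hsEmbed (rankOne ℝ _ _), hsNorm_rankOne, cross, hk,
      real_inner_self_eq_norm_sq]
    ring

theorem algS_succ (hk : ∀ s t, k s t = inner ℝ (φ s) (φ t)) (g : ℕ → F) (t : ℕ) :
    algS k g (t + 1) = hsNorm (∑ s ∈ Finset.Ico 1 (t + 1), rankOne ℝ (g s) (φ s)) := by
  rw [algS, algSqS_succ hk, Real.sqrt_sq (hsNorm_nonneg _)]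

theorem play_eq_operatorIterate (hk : ∀ s t, k s t = inner ℝ (φ s) (φ t)) (ε G₀ : ℝ) (g : ℕ → F)
    {t : ℕ} (ht : 1 ≤ t) : play k ε G₀ g t = operatorIterate φ ε G₀ g t (φ t) := by
  match t, ht with
  | 1, _ => simp [play, operatorIterate]
  | t + 2, _ =>
    simp only [play, operatorIterate, algS_succ hk, algV_succ, hsNorm_rankOne, mul_pow, hk,
      real_inner_self_eq_norm_sq, _root_.smul_apply, _root_.neg_apply,
      _root_.sum_apply, InnerProductSpace.rankOne_apply]
    rfl

theorem dynamicRegret_play_eq_staticRegret (hk : ∀ s t, k s t = inner ℝ (φ s) (φ t)) (ε G₀ : ℝ)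
    (g : ℕ → F) (ℓ : ℕ → F → ℝ) {T : ℕ} {u : ℕ → F} {U : H →L[ℝ] F}
    (hU : ∀ t ∈ Finset.Icc 1 T, u t = U (φ t)) :
    dynamicRegret T ℓ (play k ε G₀ g) u =
      staticRegret T (fun t (W : H →L[ℝ] F) => ℓ t (W (φ t))) (operatorIterate φ ε G₀ g) U :=
  Finset.sum_congr rfl fun t ht => by
    rw [play_eq_operatorIterate hk _ _ _ (Finset.mem_Icc.1 ht).1, hU t ht]

theorem dynamicRegret_play_le {ε G₀ : ℝ} (hε : 0 < ε) (hG₀ : 0 < G₀)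
    (hk : ∀ s t, k s t = inner ℝ (φ s) (φ t)) {T : ℕ} {ℓ : ℕ → F → ℝ} {g : ℕ → F}
    (hbound : ∀ t ∈ Finset.Icc 1 T, ‖g t‖ * √(k t t) ≤ G₀)
    (hg : ∀ t ∈ Finset.Icc 1 T, g t ∈ subdifferential (ℓ t) (play k ε G₀ g t)) {u : ℕ → F}
    {U : H →L[ℝ] F} (hU : ∀ t ∈ Finset.Icc 1 T, u t = U (φ t)) :
    dynamicRegret T ℓ (play k ε G₀ g) u ≤
      regretBound ε G₀ (4 * G₀ ^ 2 + ∑ t ∈ Finset.Icc 1 T, ‖g t‖ ^ 2 * k t t) (hsNorm U) := by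
  have hdiag : ∀ t, k t t = ‖φ t‖ ^ 2 := fun t => by rw [hk, real_inner_self_eq_norm_sq]
  simp only [hdiag, Real.sqrt_sq (norm_nonneg _)] at hbound ⊢
  calc dynamicRegret T ℓ (play k ε G₀ g) u
      ≤ ∑ t ∈ Finset.Icc 1 T, inner ℝ (g t) (play k ε G₀ g t - u t) :=
        dynamicRegret_le_sum_inner hg u
    _ = ∑ t ∈ Finset.Icc 1 T, inner ℝ (g t) (operatorIterate φ ε G₀ g t (φ t) - U (φ t)) :=
        Finset.sum_congr rfl fun t ht => by
          rw [play_eq_operatorIterate hk _ _ _ (Finset.mem_Icc.1 ht).1, hU t ht]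
    _ ≤ _ := sum_inner_operatorIterate_sub_le hε hG₀ hbound U

end Algorithm

end KernelOCO

end

open KernelOCO in
theorem mainTheorem9_general {F H : Type*} [NormedAddCommGroup F] [InnerProductSpace ℝ F]
    [FiniteDimensional ℝ F] [NormedAddCommGroup H] [InnerProductSpace ℝ H] [CompleteSpace H]
    {T : ℕ} {k : ℕ → ℕ → ℝ} {φ : ℕ → H} (hk : ∀ s t, k s t = inner ℝ (φ s) (φ t))
    {ε G₀ : ℝ} (hε : 0 < ε) (hG₀ : 0 < G₀) {ℓ : ℕ → F → ℝ} {g : ℕ → F}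
    (hbound : ∀ t ∈ Finset.Icc 1 T, ‖g t‖ * √(k t t) ≤ G₀)
    (hg : ∀ t ∈ Finset.Icc 1 T, g t ∈ subdifferential (ℓ t) (play k ε G₀ g t))
    {u : ℕ → F} {U : H →L[ℝ] F} (hU : ∀ t ∈ Finset.Icc 1 T, u t = U (φ t)) :
    dynamicRegret T ℓ (play k ε G₀ g) u =
        staticRegret T (fun t (W : H →L[ℝ] F) => ℓ t (W (φ t))) (operatorIterate φ ε G₀ g) U ∧
      dynamicRegret T ℓ (play k ε G₀ g) u ≤
        regretBound ε G₀ (4 * G₀ ^ 2 + ∑ t ∈ Finset.Icc 1 T, ‖g t‖ ^ 2 * k t t) (hsNorm U) :=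
  ⟨dynamicRegret_play_eq_staticRegret hk ε G₀ g ℓ hU, dynamicRegret_play_le hε hG₀ hk hbound hg hU⟩

open KernelOCO in
theorem mainTheorem9
    {X H : Type*} [NormedAddCommGroup H] [InnerProductSpace ℝ H] [CompleteSpace H]
    [RKHS ℝ H X ℝ] {d T : ℕ}
    -- `τ t` is the point of the index set `X` that stands for the time `t`
    (τ : ℕ → X)
    (k : ℕ → ℕ → ℝ) (hk : k = fun s t => repKernel H (τ s) (τ t))
    (φ : ℕ → H) (hφ : φ = fun t => feature H (τ t))
    (G : ℝ≥0) (ε : ℝ) (hε : 0 < ε)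
    (G₀ : ℝ) (hG₀ : G₀ = liftedLipschitz k G T) (hG₀_pos : 0 < G₀)
    (ℓ : ℕ → EuclideanSpace ℝ (Fin d) → ℝ)
    (hconv : ∀ t ∈ Finset.Icc 1 T, ConvexOn ℝ Set.univ (ℓ t))
    (hlip : ∀ t ∈ Finset.Icc 1 T, LipschitzWith G (ℓ t))
    (g w : ℕ → EuclideanSpace ℝ (Fin d))
    (hw : w = play k ε G₀ g)
    (hg : ∀ t ∈ Finset.Icc 1 T, g t ∈ subdifferential (ℓ t) (w t))
    (u : ℕ → EuclideanSpace ℝ (Fin d)) (U : H →L[ℝ] EuclideanSpace ℝ (Fin d))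
    (hU : ∀ t ∈ Finset.Icc 1 T, u t = U (φ t))
    (V α : ℝ)
    (hV : V = 4 * G₀ ^ 2 + ∑ t ∈ Finset.Icc 1 T, ‖g t‖ ^ 2 * k t t)
    (hα : α = ε * G₀ / (Real.sqrt V * Real.log (V / G₀ ^ 2) ^ 2)) :
    dynamicRegret T ℓ w u =
        staticRegret T (fun t (W : H →L[ℝ] EuclideanSpace ℝ (Fin d)) => ℓ t (W (φ t)))
          (operatorIterate φ ε G₀ g) U ∧
      dynamicRegret T ℓ w u ≤
        4 * G₀ * ε + 6 * hsNorm U *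
          max (Real.sqrt (V * Real.log (hsNorm U / α + 1)))
            (G₀ * Real.log (hsNorm U / α + 1)) := by
  subst hw hV hα
  exact mainTheorem9_general (fun s t => by subst hk hφ; exact repKernel_eq_inner _ _) hε hG₀_pos
    (fun t ht => hG₀ ▸ norm_mul_sqrt_le_liftedLipschitz k (hlip t ht) (hg t ht) ht) hg hU
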